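/- Let $\beta\in(0,1)$, let $\Gamma$ be a correspondence assigning to each $(k,h)\in\mathbb{R}_+^2$ a subset of $\mathbb{R}_+^2$, with graph $\mathrm{gr}(\Gamma)=\{(k,h,k',h'):(k',h')\in\Gamma(k,h)\}$, let $F:\mathbb{R}_+^2\times\mathbb{R}_+^2\to\mathbb{R}\cup\{-\infty\}$, and let $\|\cdot\|$ be any norm on $\mathbb{R}^2$. Assume: (A1) $\Gamma$ is nonempty-valued, compact-valued and continuous (upper and lower hemicontinuous), and $(0,0)\in\Gamma(0,0)$. (A2) There are constants $\zeta,\zeta'\ge 0$ with $\zeta\ne 1$ such that $(k',h')\in\Gamma(k,h)$ implies $\|k',h'\|\le\zeta\|k,h\|+\zeta'$. (A3) There are constants $\eta,\eta'\ge 0$ such that $F(k,h,k',h')\le\eta(\|k,h\|+\|k',h'\|)+\eta'$ for all $(k,h,k',h')\in\mathrm{gr}(\Gamma)$. (A4) If $\zeta>0$ in (A2), then $\beta\zeta<1$. (A5) $F$ (restricted to $\mathrm{gr}(\Gamma)$) is continuous at every point of $\mathrm{gr}(\Gamma)$ where $F>-\infty$; and if $F=-\infty$ at a point of $\mathrm{gr}(\Gamma)$,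 then $F\to-\infty$ along every sequence in $\mathrm{gr}(\Gamma)$ converging to that point. For $(k_0,h_0)\in\mathbb{R}_+^2$ let $\Pi(k_0,h_0)$ be the set of sequences $(\mathbf{k},\mathbf{h})=\{(k_t,h_t)\}_{t\ge0}$ starting at $(k_0,h_0)$ with $(k_{t+1},h_{t+1})\in\Gamma(k_t,h_t)$ for all $t\ge 0$. Then for every $(\mathbf{k},\mathbf{h})\in\Pi(k_0,h_0)$ the sum $J(\mathbf{k},\mathbf{h})=\lim_{T\to\infty}\sum_{t=0}^{T}\beta^tF(k_t,h_t,k_{t+1},h_{t+1})$ is well defined as a limit in $[-\infty,+\infty]$. Put $\Pi'(k_0,h_0)=\{(\mathbf{k},\mathbf{h})\in\Pi(k_0,h_0):J(\mathbf{k},\mathbf{h})>-\infty\}$ and $V(k_0,h_0)=\sup\{J(\mathbf{k},\mathbf{h}):(\mathbf{k},\mathbf{h})\in\Pi(k_0,h_0)\}$. Let $S$ be the set of upper semicontinuous $W:\mathbb{R}_+^2\to\mathbb{R}\cup\{-\infty\}$ such that (S1) $\limsup_{t\to\infty}\beta^tW(k_t,h_t)\le 0$ for all $(k_0,h_0)$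 and all $(\mathbf{k},\mathbf{h})\in\Pi(k_0,h_0)$, and (S2) $\lim_{t\to\infty}\beta^tW(k_t,h_t)=0$ for all $(k_0,h_0)$ and all $(\mathbf{k},\mathbf{h})\in\Pi'(k_0,h_0)$. Then: (a) $V(k,h)=\sup\{F(k,h,k',h')+\beta V(k',h'):(k',h')\in\Gamma(k,h)\}$ for all $(k,h)\in\mathbb{R}_+^2$. (b) $V\in S$, and $V$ is the unique solution in $S$ of the Bellman equation in (a). (c) Suppose in addition that (A6) holds: (A6a) $(k,h,k',h')\in\mathrm{gr}(\Gamma)$ and $\lambda\in(0,1]$ imply $(\lambda k,\lambda h,\lambda k',\lambda h')\in\mathrm{gr}(\Gamma)$; (A6b) there are continuous $\Phi_1,\Phi_2:(0,1]\to\mathbb{R}$ with $\Phi_1(1)=1$, $\Phi_2(1)=0$ and $F(\lambda k,\lambda h,\lambda k',\lambda h')\ge\Phi_1(\lambda)F(k,h,k',h')+\Phi_2(\lambda)$ for all $\lambda\in(0,1]$ and all points of $\mathrm{gr}(\Gamma)$ with $F(k,h,k',h')>-\infty$; (A6c) for every $(\tilde k,\tilde h)\in\mathbb{R}_+^2$,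 every $(k',h')\in\Gamma(\tilde k,\tilde h)$ and every sufficiently small $\varepsilon>0$ there is a neighborhood $\mathcal N$ of $(\tilde k,\tilde h)$ in $\mathbb{R}_+^2$ with $((1-\varepsilon)k',(1-\varepsilon)h')\in\Gamma(k,h)$ for all $(k,h)\in\mathcal N$. Then $V$ is continuous at every point $(k_t,h_t)$, $t\ge 0$, of every path $(\mathbf{k},\mathbf{h})\in\Pi'(k_0,h_0)$, for every $(k_0,h_0)$; and if $V(k_0,h_0)=-\infty$, then $V(k_n,h_n)\to-\infty$ for every sequence $(k_n,h_n)\to(k_0,h_0)$ in $\mathbb{R}_+^2$. Moreover, (A6) is satisfied by the two-sector model with isoelastic utility. Let $U(c)=(c^\theta-1)/\theta$ for $\theta\le 1$, $\theta\neq 0$, and $U(c)=\log c$ for $\theta=0$ (for $c\ge 0$, with $U(0)=-\infty$ if $\theta\le 0$, and $U(c)=-\infty$ for $c<0$). Then $U(\lambda c)=\lambda^\theta U(c)+U(\lambda)$ for all $c,\lambda>0$. Let $A,B>0$, $\alpha,\delta_k,\delta_h\in(0,1)$, $n\ge 0$, let $\phi$ be continuous and strictly increasing on $[0,1]$ with $\phi(0)=0$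 and $\phi(1)>\delta_h/B$, and let $D_h=B\phi(1)+1-\delta_h$. Let $\Gamma(k,h)$ be the set of $(k',h')\in\mathbb{R}_+^2$ with $(1+n)k'\le Ak^\alpha h^{1-\alpha}+(1-\delta_k)k$ and $h'\le D_hh$. Let $\psi(h,h')=1$ if $h=0$ or $h'\le(1-\delta_h)h$, and $\psi(h,h')=1-\phi^{-1}\big(\tfrac1B(\tfrac{h'}{h}-(1-\delta_h))\big)$ if $h>0$ and $(1-\delta_h)h\le h'\le D_hh$. Let $F(k,h,k',h')=U\big(Ak^\alpha(\psi(h,h')h)^{1-\alpha}+(1-\delta_k)k-(1+n)k'\big)$ if $k,h>0$, and $F(k,h,k',h')=U\big(\max\{0,(1-\delta_k)k-(1+n)k'\}\big)$ if $k=0$ or $h=0$. Then this $\Gamma$ and $F$ satisfy (A6). -/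

import Mathlib

open Set Filter Topology
open scoped NNReal

noncomputable section

namespace GrowthModel

/-- The state space `ℝ₊²`, with points `(k, h)`. -/
abbrev State : Type := ℝ≥0 × ℝ≥0

/-- The inclusion of `ℝ₊²` into `ℝ²`. -/
def toPlane (x : State) : ℝ × ℝ := ((x.1 : ℝ), (x.2 : ℝ))

/-- The graph of a correspondence on `ℝ₊²`. -/
def graph (Γ : State → Set State) : Set (State × State) := {p | p.2 ∈ Γ p.1}

/-! ### Feasible paths, discounted returns, value function -/

/-- `Π(x₀)`: the paths of states that are feasible from `x₀`. -/
def feasible (Γ : State → Set State) (x₀ : State) : Set (ℕ → State) :=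
  {x | x 0 = x₀ ∧ ∀ t, x (t + 1) ∈ Γ (x t)}

/-- The partial sum `∑_{t < T} β^t F(x_t, x_{t+1})`. -/
def partialReturn (β : ℝ) (F : State × State → EReal) (x : ℕ → State) (T : ℕ) : EReal :=
  ∑ t ∈ Finset.range T, ((β ^ t : ℝ) : EReal) * F (x t, x (t + 1))

/-- Total discounted returns `J(x) = ∑_{t ≥ 0} β^t F(x_t, x_{t+1})`. The upper limit of the partial
sums is their limit whenever this limit exists in the extended reals. -/
def totalReturn (β : ℝ) (F : State × State → EReal) (x : ℕ → State) : EReal :=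
  limsup (partialReturn β F x) atTop

/-- `Π'(x₀)`: the feasible paths from `x₀` with `J > -∞`. -/
def feasibleFinite (β : ℝ) (Γ : State → Set State) (F : State × State → EReal) (x₀ : State) :
    Set (ℕ → State) :=
  {x | x ∈ feasible Γ x₀ ∧ ⊥ < totalReturn β F x}

/-- The value function `V(x₀) = sup {J(x) : x ∈ Π(x₀)}`. -/
def value (β : ℝ) (Γ : State → Set State) (F : State × State → EReal) (x₀ : State) : EReal :=
  sSup (totalReturn β F '' feasible Γ x₀)

/-- `W` solves the Bellman equation. -/
def SolvesBellman (β : ℝ) (Γ : State → Set State) (F : State × State → EReal)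
    (W : State → EReal) : Prop :=
  ∀ x, W x = sSup {v | ∃ y ∈ Γ x, v = F (x, y) + (β : EReal) * W y}

/-- The space `S` of upper semicontinuous functions `W : ℝ₊² → ℝ ∪ {-∞}` satisfying (S1), (S2). -/
structure MemS (β : ℝ) (Γ : State → Set State) (F : State × State → EReal)
    (W : State → EReal) : Prop where
  ne_top : ∀ x, W x ≠ ⊤
  usc : UpperSemicontinuous W
  s1 : ∀ x₀, ∀ x ∈ feasible Γ x₀,
    limsup (fun t : ℕ => ((β ^ t : ℝ) : EReal) * W (x t)) atTop ≤ 0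
  s2 : ∀ x₀, ∀ x ∈ feasibleFinite β Γ F x₀,
    Tendsto (fun t : ℕ => ((β ^ t : ℝ) : EReal) * W (x t)) atTop (𝓝 0)

/-! ### The assumptions -/

/-- (A1): `Γ` is a nonempty, continuous, compact-valued correspondence, and `0 ∈ Γ(0)`. -/
structure A1 (Γ : State → Set State) : Prop where
  nonempty : ∀ x, (Γ x).Nonempty
  upper : UpperHemicontinuous Γ
  lower : LowerHemicontinuous Γ
  compact : ∀ x, IsCompact (Γ x)
  zero_mem : (0 : State) ∈ Γ 0

/-- (A2), with constants `ζ`, `ζ'`, for the norm `N` on `ℝ²`. -/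
structure A2 (N : Seminorm ℝ (ℝ × ℝ)) (Γ : State → Set State) (ζ ζ' : ℝ) : Prop where
  nonneg : 0 ≤ ζ
  nonneg' : 0 ≤ ζ'
  ne_one : ζ ≠ 1
  bound : ∀ x, ∀ y ∈ Γ x, N (toPlane y) ≤ ζ * N (toPlane x) + ζ'

/-- (A3), for the norm `N` on `ℝ²`. -/
def A3 (N : Seminorm ℝ (ℝ × ℝ)) (Γ : State → Set State) (F : State × State → EReal) : Prop :=
  ∃ η η' : ℝ, 0 ≤ η ∧ 0 ≤ η' ∧ ∀ x, ∀ y ∈ Γ x,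
    F (x, y) ≤ ((η * (N (toPlane x) + N (toPlane y)) + η' : ℝ) : EReal)

/-- (A4), for the constant `ζ` of (A2). -/
def A4 (β ζ : ℝ) : Prop := 0 < ζ → β * ζ < 1

/-- (A5): continuity of the return function on the graph of `Γ`. -/
structure A5 (Γ : State → Set State) (F : State × State → EReal) : Prop where
  continuous : ∀ p ∈ graph Γ, F p ≠ ⊥ → ContinuousWithinAt F (graph Γ) p
  tendsto_bot : ∀ p ∈ graph Γ, F p = ⊥ → ∀ q : ℕ → State × State, (∀ n, q n ∈ graph Γ) →
    Tendsto q atTop (𝓝 p) → Tendsto (fun n => F (q n)) atTop (𝓝 ⊥)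

/-- (A6). The inequality in (b) is required where `F > -∞` (its right-hand side being `-∞`
elsewhere). -/
structure A6 (Γ : State → Set State) (F : State × State → EReal) : Prop where
  a : ∀ p ∈ graph Γ, ∀ l : ℝ≥0, 0 < l → l ≤ 1 → l • p ∈ graph Γ
  b : ∃ Φ₁ Φ₂ : ℝ≥0 → ℝ, ContinuousOn Φ₁ (Ioc 0 1) ∧ ContinuousOn Φ₂ (Ioc 0 1) ∧
    Φ₁ 1 = 1 ∧ Φ₂ 1 = 0 ∧
    ∀ p ∈ graph Γ, F p ≠ ⊥ → ∀ l : ℝ≥0, 0 < l → l ≤ 1 →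
      (Φ₁ l : EReal) * F p + (Φ₂ l : EReal) ≤ F (l • p)
  c : ∀ x : State, ∀ y ∈ Γ x, ∃ ε₀ : ℝ≥0, 0 < ε₀ ∧ ε₀ ≤ 1 ∧ ∀ ε : ℝ≥0, 0 < ε → ε < ε₀ →
    ∀ᶠ z in 𝓝 x, (1 - ε) • y ∈ Γ z

/-! ### The two-sector model with isoelastic utility -/

/-- Isoelastic utility with parameter `θ ≤ 1`, with values in `ℝ ∪ {-∞}`. Negative
consumption, which is infeasible, gets utility `-∞`. -/
def utility (θ c : ℝ) : EReal :=
  if c < 0 ∨ (c = 0 ∧ θ ≤ 0) then ⊥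
  else if θ = 0 then ((Real.log c : ℝ) : EReal)
  else (((c ^ θ - 1) / θ : ℝ) : EReal)

/-- The parameters of the model. -/
structure Params where
  (A α B δk δh n θ : ℝ)
  φ : ℝ → ℝ
  A_pos : 0 < A
  α_pos : 0 < α
  α_lt : α < 1
  B_pos : 0 < B
  δk_pos : 0 < δk
  δk_lt : δk < 1
  δh_pos : 0 < δh
  δh_lt : δh < 1
  n_nonneg : 0 ≤ n
  θ_le : θ ≤ 1
  φ_cont : ContinuousOn φ (Icc 0 1)
  φ_mono : StrictMonoOn φ (Icc 0 1)
  φ_zero : φ 0 = 0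
  φ_one : δh / B < φ 1

namespace Params

variable (M : Params)

/-- The maximal growth factor `D_h` of human capital. -/
def Dh : ℝ := M.B * M.φ 1 + (1 - M.δh)

/-- The feasibility correspondence of the model. -/
def Gam (x : State) : Set State :=
  {y | (y.1 : ℝ) ≤ (M.A * (x.1 : ℝ) ^ M.α * (x.2 : ℝ) ^ (1 - M.α) + (1 - M.δk) * x.1) / (1 + M.n) ∧
    (y.2 : ℝ) ≤ M.Dh * x.2}

/-- The time `ψ(h, h')` left for market activities; `φ⁻¹` is the inverse of `φ` on `[0, 1]`. -/
def psi (h h' : ℝ) : ℝ :=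
  if h = 0 ∨ h' ≤ (1 - M.δh) * h then 1
  else 1 - Function.invFunOn M.φ (Icc 0 1) ((h' / h - (1 - M.δh)) / M.B)

/-- The return function of the model. -/
def ret (p : State × State) : EReal :=
  if p.1.1 = 0 ∨ p.1.2 = 0 then
    utility M.θ (max 0 ((1 - M.δk) * p.1.1 - (1 + M.n) * p.2.1))
  else
    utility M.θ (M.A * (p.1.1 : ℝ) ^ M.α * (M.psi p.1.2 p.2.2 * p.1.2) ^ (1 - M.α)
      + (1 - M.δk) * p.1.1 - (1 + M.n) * p.2.1)

end Params

end GrowthModel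

end

namespace GrowthModel

/-! ### Extended real arithmetic -/

/-! Everything rests on a dominating function `b` (`IsBound`): continuous and real-valued, with `F
(x, y) + β b(y) ≤ b(x)` on the graph and `β ^ t * b (x t) → 0` along feasible paths. The growth
conditions provide one, affine in the norm (`exists_isBound`). Adding `β ^ T * b (x T)` to the
partial sums makes them antitone in `T`, so `J` exists and is an infimum of continuous functions of
the path, hence upper semicontinuous on path space.

The paths starting in a compact set form a compact set (`isCompact_pathsFrom`), so optimal paths
exist. This gives the Bellman equation, and projecting superlevel sets of `J` to the initial state
gives upper semicontinuity of `V`. For uniqueness, an upper semicontinuous solution `W` has a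
maximizing successor at every state. Following these successors and using (S1) gives `W ≤ V`, while
(S2) along paths with `J > -∞` gives `V ≤ W`.

For (c) only lower semicontinuity is missing (`IsBound.value_lsc`): the second state `y` of an
optimal path is shrunk to `(1 - ε) • y`, which is feasible from all nearby initial states, and the
continuation is the optimal path from `y` scaled by `1 - ε`. In the two-sector model (A6) comes from
homogeneity of degree one of resources and consumption. -/

lemma coe_pow_mul_ne_top {β : ℝ} (hβ : 0 < β) {a : EReal} (ha : a ≠ ⊤) (t : ℕ) :
    ((β ^ t : ℝ) : EReal) * a ≠ ⊤ := by
  have h : 0 < β ^ t := pow_pos hβ t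
  induction a with
  | bot => rw [EReal.coe_mul_bot_of_pos h]; exact bot_ne_top
  | coe r => rw [← EReal.coe_mul]; exact EReal.coe_ne_top _
  | top => exact absurd rfl ha

lemma coe_mul_add {c : ℝ} (hc : 0 ≤ c) (a b : EReal) :
    (c : EReal) * (a + b) = c * a + c * b :=
  EReal.left_distrib_of_nonneg_of_ne_top (EReal.coe_nonneg.2 hc) (EReal.coe_ne_top c) a b

lemma coe_mul_le_coe_mul {c : ℝ} (hc : 0 ≤ c) {a b : EReal} (h : a ≤ b) :
    (c : EReal) * a ≤ c * b :=
  mul_le_mul_of_nonneg_left h (EReal.coe_nonneg.2 hc)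

lemma tendsto_coe_mul {ι : Type*} {l : Filter ι} {u : ι → EReal} {a : EReal} (c : ℝ)
    (h : Tendsto u l (𝓝 a)) : Tendsto (fun i => (c : EReal) * u i) l (𝓝 (c * a)) :=
  EReal.Tendsto.const_mul h (.inl (EReal.coe_ne_bot c)) (.inl (EReal.coe_ne_top c))

/-- Addition on `EReal` is discontinuous only where `⊤` meets `⊥`; excluding `⊤` suffices, as
returns and values may be `⊥` but never `⊤`. -/
lemma tendsto_add_of_ne_top {ι : Type*} {l : Filter ι} {u v : ι → EReal} {a b : EReal}
    (hu : Tendsto u l (𝓝 a)) (hv : Tendsto v l (𝓝 b)) (ha : a ≠ ⊤) (hb : b ≠ ⊤) :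
    Tendsto (fun i => u i + v i) l (𝓝 (a + b)) :=
  (EReal.continuousAt_add (p := (a, b)) (.inl ha) (.inr hb)).tendsto.comp (hu.prodMk_nhds hv)

/-! ### Partial sums -/

variable {β : ℝ} {Γ : State → Set State} {F : State × State → EReal}

lemma partialReturn_zero (x : ℕ → State) : partialReturn β F x 0 = 0 := by
  simp [partialReturn]

lemma partialReturn_succ (x : ℕ → State) (T : ℕ) :
    partialReturn β F x (T + 1) =
      partialReturn β F x T + ((β ^ T : ℝ) : EReal) * F (x T, x (T + 1)) := by
  simp [partialReturn, Finset.sum_range_succ]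

lemma partialReturn_one (x : ℕ → State) : partialReturn β F x 1 = F (x 0, x 1) := by
  simp [partialReturn]

lemma partialReturn_ne_top (hβ : 0 < β) (hF : ∀ p, F p ≠ ⊤) (x : ℕ → State) (T : ℕ) :
    partialReturn β F x T ≠ ⊤ := by
  induction T with
  | zero => simp [partialReturn_zero]
  | succ T ih =>
    rw [partialReturn_succ]
    exact EReal.add_ne_top ih (coe_pow_mul_ne_top hβ (hF _) T)

lemma partialReturn_add (hβ : 0 < β) (x : ℕ → State) (n T : ℕ) :
    partialReturn β F x (n + T) = partialReturn β F x n +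
      ((β ^ n : ℝ) : EReal) * partialReturn β F (fun t => x (n + t)) T := by
  induction T with
  | zero => simp [partialReturn_zero]
  | succ T ih =>
    rw [← add_assoc, partialReturn_succ, ih, partialReturn_succ,
      coe_mul_add (pow_pos hβ n).le, add_assoc, ← mul_assoc, ← EReal.coe_mul, ← pow_add, add_assoc]

lemma partialReturn_eq_coe {x : ℕ → State} {f : ℕ → ℝ} (hf : ∀ t, F (x t, x (t + 1)) = f t)
    (T : ℕ) : partialReturn β F x T = ((∑ t ∈ Finset.range T, β ^ t * f t : ℝ) : EReal) := by
  induction T with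
  | zero => simp [partialReturn_zero]
  | succ T ih => rw [partialReturn_succ, ih, hf, Finset.sum_range_succ]; norm_cast

/-! ### Feasible paths -/

lemma shift_mem_feasible {x₀ : State} {x : ℕ → State} (hx : x ∈ feasible Γ x₀) (n : ℕ) :
    (fun t => x (n + t)) ∈ feasible Γ (x n) :=
  ⟨rfl, fun t => hx.2 (n + t)⟩

/-- The path that starts at `x` and continues with `z`. -/
def consPath (x : State) (z : ℕ → State) : ℕ → State
  | 0 => x
  | t + 1 => z t

lemma consPath_mem {x y : State} {z : ℕ → State} (hy : y ∈ Γ x) (hz : z ∈ feasible Γ y) :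
    consPath x z ∈ feasible Γ x := by
  refine ⟨rfl, fun t => ?_⟩
  cases t with
  | zero => simpa [consPath, hz.1] using hy
  | succ t => exact hz.2 t

lemma shift_consPath (x : State) (z : ℕ → State) : (fun t => consPath x z (1 + t)) = z := by
  funext t
  rw [add_comm]
  rfl

lemma exists_path_of_step {R : State → State → Prop} (h : ∀ x, ∃ y, R x y) (x₀ : State) :
    ∃ x : ℕ → State, x 0 = x₀ ∧ ∀ t, R (x t) (x (t + 1)) := by
  choose g hg using h
  refine ⟨fun t => g^[t] x₀, rfl, fun t => ?_⟩
  simpa only [Function.iterate_succ_apply'] using hg _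

/-- The feasible paths that start in `K`. -/
def pathsFrom (Γ : State → Set State) (K : Set State) : Set (ℕ → State) :=
  {x | x 0 ∈ K ∧ ∀ t, x (t + 1) ∈ Γ (x t)}

/-- Upper hemicontinuity keeps `Γ` inside a compact neighbourhood of `Γ x` for all points near `x`;
finitely many such neighbourhoods serve all of `K`. -/
lemma exists_isCompact_image (h : A1 Γ) {K : Set State} (hK : IsCompact K) :
    ∃ C, IsCompact C ∧ ∀ x ∈ K, Γ x ⊆ C := by
  refine hK.induction_on (p := fun s => ∃ C, IsCompact C ∧ ∀ x ∈ s, Γ x ⊆ C)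
    ⟨∅, isCompact_empty, by simp⟩ ?_ ?_ ?_
  · rintro s t hst ⟨C, hC, h⟩
    exact ⟨C, hC, fun x hx => h x (hst hx)⟩
  · rintro s t ⟨C, hC, h⟩ ⟨D, hD, h'⟩
    refine ⟨C ∪ D, hC.union hD, ?_⟩
    rintro x (hx | hx)
    · exact (h x hx).trans subset_union_left
    · exact (h' x hx).trans subset_union_right
  · intro x _
    obtain ⟨C, hC, hxC⟩ := exists_compact_superset (h.compact x)
    refine ⟨_, nhdsWithin_le_nhds (h.upper.forall_isOpen x _ isOpen_interior hxC), C, hC, ?_⟩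
    intro z hz
    exact Subset.trans hz interior_subset

lemma isClosed_graph (h : A1 Γ) : IsClosed (graph Γ) := by
  refine isClosed_of_closure_subset fun p hp => ?_
  obtain ⟨u, hu, hup⟩ := mem_closure_iff_seq_limit.1 hp
  exact UpperHemicontinuousAt.mem_of_tendsto (h.upper p.1) (h.compact p.1).isClosed
    ((continuous_fst.tendsto p).comp hup) (Frequently.of_forall hu)
    ((continuous_snd.tendsto p).comp hup)

/-- Iterating `exists_isCompact_image` confines the state at each date to a fixed compact set. By
Tychonoff the product is compact, and the paths are a closed subset because the graph is closed. -/
lemma isCompact_pathsFrom (h : A1 Γ) {K : Set State} (hK : IsCompact K) :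
    IsCompact (pathsFrom Γ K) := by
  have key : ∀ C : {C : Set State // IsCompact C}, ∃ D : {C : Set State // IsCompact C},
      ∀ x ∈ C.1, Γ x ⊆ D.1 := fun C => by
    obtain ⟨D, hD, h⟩ := exists_isCompact_image h C.2
    exact ⟨⟨D, hD⟩, h⟩
  choose g hg using key
  have hC : IsCompact {x : ℕ → State | ∀ t, x t ∈ (g^[t] ⟨K, hK⟩).1} :=
    isCompact_pi_infinite fun t => (g^[t] ⟨K, hK⟩).2
  refine hC.of_isClosed_subset ?_ ?_
  · have : pathsFrom Γ K = (fun x : ℕ → State => x 0) ⁻¹' K ∩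
        ⋂ t, (fun x : ℕ → State => (x t, x (t + 1))) ⁻¹' graph Γ := by
      ext x; simp [pathsFrom, graph]
    rw [this]
    exact (hK.isClosed.preimage (continuous_apply 0)).inter (isClosed_iInter fun t =>
      (isClosed_graph h).preimage ((continuous_apply t).prodMk (continuous_apply (t + 1))))
  · intro x hx t
    induction t with
    | zero => exact hx.1
    | succ t ih =>
      rw [Function.iterate_succ_apply']
      exact hg _ _ ih (hx.2 t)

lemma feasible_nonempty (h : A1 Γ) (x₀ : State) : (feasible Γ x₀).Nonempty :=
  exists_path_of_step h.nonempty x₀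

lemma A5.continuousOn (h : A5 Γ F) : ContinuousOn F (graph Γ) := by
  intro p hp
  by_cases hb : F p = ⊥
  · refine tendsto_of_seq_tendsto fun q hq => ?_
    rw [hb]
    obtain ⟨hq, hq'⟩ := tendsto_nhdsWithin_iff.1 hq
    -- The sequence lies in the graph only eventually, whereas `tendsto_bot` wants every term there,
    -- so the first `m` terms are dropped.
    obtain ⟨m, hm⟩ := eventually_atTop.1 hq'
    exact (tendsto_add_atTop_iff_nat m).1 (h.tendsto_bot p hp hb (fun n => q (n + m))
      (fun n => hm _ (Nat.le_add_left _ _)) ((tendsto_add_atTop_iff_nat m).2 hq))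
  · exact h.continuous p hp hb

lemma continuousOn_partialReturn (hβ : 0 < β) (hF : ∀ p, F p ≠ ⊤) (h5 : A5 Γ F)
    (K : Set State) (T : ℕ) :
    ContinuousOn (fun x => partialReturn β F x T) (pathsFrom Γ K) := by
  induction T with
  | zero => simpa [partialReturn_zero] using continuousOn_const
  | succ T ih =>
    intro x hx
    have hT : ContinuousWithinAt (fun x : ℕ → State => F (x T, x (T + 1))) (pathsFrom Γ K) x :=
      (h5.continuousOn (x T, x (T + 1)) (hx.2 T)).comp
        (f := fun x : ℕ → State => (x T, x (T + 1)))
        ((continuous_apply T).prodMk (continuous_apply (T + 1))).continuousWithinAt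
        fun y hy => hy.2 T
    simp only [partialReturn_succ]
    exact tendsto_add_of_ne_top (ih x hx) (tendsto_coe_mul _ hT) (partialReturn_ne_top hβ hF x T)
      (coe_pow_mul_ne_top hβ (hF _) T)

/-! ### A dominating function -/

/-- `b` is a continuous upper solution of the Bellman equation whose discounted values vanish
along all feasible paths. -/
structure IsBound (β : ℝ) (Γ : State → Set State) (F : State × State → EReal) (b : State → ℝ) :
    Prop where
  continuous : Continuous b
  step : ∀ x, ∀ y ∈ Γ x, F (x, y) + ((β * b y : ℝ) : EReal) ≤ b x
  decay : ∀ x₀, ∀ x ∈ feasible Γ x₀, Tendsto (fun t => β ^ t * b (x t)) atTop (𝓝 0)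

section Bound

variable {b : State → ℝ}

/-- Each term is the return up to date `T` plus an overestimate of the rest; the inequality `step`,
discounted by `β ^ T`, says that waiting one more period can only lower it. -/
lemma IsBound.antitone (hb : IsBound β Γ F b) (hβ : 0 < β) {x₀ : State} {x : ℕ → State}
    (hx : x ∈ feasible Γ x₀) :
    Antitone fun T => partialReturn β F x T + ((β ^ T * b (x T) : ℝ) : EReal) := by
  refine antitone_nat_of_succ_le fun T => ?_
  have h := coe_mul_le_coe_mul (pow_pos hβ T).le (hb.step _ _ (hx.2 T))
  rw [coe_mul_add (pow_pos hβ T).le, ← EReal.coe_mul, ← EReal.coe_mul, ← mul_assoc,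
    ← pow_succ] at h
  rw [partialReturn_succ, add_assoc]
  gcongr

lemma IsBound.tendsto_iInf (hb : IsBound β Γ F b) (hβ : 0 < β) {x₀ : State} {x : ℕ → State}
    (hx : x ∈ feasible Γ x₀) :
    Tendsto (partialReturn β F x) atTop
      (𝓝 (⨅ T, partialReturn β F x T + ((β ^ T * b (x T) : ℝ) : EReal))) := by
  have h1 := tendsto_atTop_iInf (hb.antitone hβ hx)
  have h2 : Tendsto (fun T => ((-(β ^ T * b (x T)) : ℝ) : EReal)) atTop (𝓝 ((0 : ℝ) : EReal)) :=
    EReal.tendsto_coe.2 (by simpa using (hb.decay _ x hx).neg)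
  -- Subtracting the vanishing real correction is harmless even if the infimum is infinite, because
  -- the second limit is finite.
  have h3 := (EReal.continuousAt_add
    (p := (⨅ T, partialReturn β F x T + ((β ^ T * b (x T) : ℝ) : EReal), ((0 : ℝ) : EReal)))
    (.inr (EReal.coe_ne_bot _)) (.inr (EReal.coe_ne_top _))).tendsto.comp (h1.prodMk_nhds h2)
  simp only [EReal.coe_zero, add_zero] at h3
  refine h3.congr fun T => ?_
  simp only [Function.comp_apply]
  rw [add_assoc, ← EReal.coe_add, add_neg_cancel, EReal.coe_zero, add_zero]

lemma IsBound.totalReturn_eq (hb : IsBound β Γ F b) (hβ : 0 < β) {x₀ : State} {x : ℕ → State}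
    (hx : x ∈ feasible Γ x₀) :
    totalReturn β F x = ⨅ T, partialReturn β F x T + ((β ^ T * b (x T) : ℝ) : EReal) :=
  (hb.tendsto_iInf hβ hx).limsup_eq

lemma IsBound.tendsto (hb : IsBound β Γ F b) (hβ : 0 < β) {x₀ : State} {x : ℕ → State}
    (hx : x ∈ feasible Γ x₀) :
    Tendsto (partialReturn β F x) atTop (𝓝 (totalReturn β F x)) :=
  hb.totalReturn_eq hβ hx ▸ hb.tendsto_iInf hβ hx

lemma IsBound.totalReturn_le (hb : IsBound β Γ F b) (hβ : 0 < β) {x₀ : State} {x : ℕ → State}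
    (hx : x ∈ feasible Γ x₀) : totalReturn β F x ≤ b x₀ := by
  rw [hb.totalReturn_eq hβ hx]
  refine (iInf_le _ 0).trans ?_
  simp [partialReturn_zero, hx.1]

lemma IsBound.totalReturn_ne_top (hb : IsBound β Γ F b) (hβ : 0 < β) {x₀ : State} {x : ℕ → State}
    (hx : x ∈ feasible Γ x₀) : totalReturn β F x ≠ ⊤ :=
  ((hb.totalReturn_le hβ hx).trans_lt (EReal.coe_lt_top _)).ne

lemma IsBound.totalReturn_split (hb : IsBound β Γ F b) (hβ : 0 < β) (hF : ∀ p, F p ≠ ⊤)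
    {x₀ : State} {x : ℕ → State} (hx : x ∈ feasible Γ x₀) (n : ℕ) :
    totalReturn β F x = partialReturn β F x n +
      ((β ^ n : ℝ) : EReal) * totalReturn β F (fun t => x (n + t)) := by
  have h1 : Tendsto (fun T => partialReturn β F x (n + T)) atTop (𝓝 (totalReturn β F x)) := by
    simpa only [add_comm n] using (tendsto_add_atTop_iff_nat n).2 (hb.tendsto hβ hx)
  simp only [partialReturn_add hβ] at h1
  exact tendsto_nhds_unique h1 (tendsto_add_of_ne_top tendsto_const_nhds
    (tendsto_coe_mul _ (hb.tendsto hβ (shift_mem_feasible hx n))) (partialReturn_ne_top hβ hF x n)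
    (coe_pow_mul_ne_top hβ (hb.totalReturn_ne_top hβ (shift_mem_feasible hx n)) n))

lemma IsBound.totalReturn_eq_add (hb : IsBound β Γ F b) (hβ : 0 < β) (hF : ∀ p, F p ≠ ⊤)
    {x₀ : State} {x : ℕ → State} (hx : x ∈ feasible Γ x₀) :
    totalReturn β F x = F (x₀, x 1) + (β : EReal) * totalReturn β F (fun t => x (1 + t)) := by
  simpa [partialReturn_one, hx.1] using hb.totalReturn_split hβ hF hx 1

/-- An infimum of continuous functions is upper semicontinuous, and `totalReturn_eq` writes `J` in
this form on paths. -/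
lemma IsBound.upperSemicontinuousOn (hb : IsBound β Γ F b) (hβ : 0 < β) (hF : ∀ p, F p ≠ ⊤)
    (h5 : A5 Γ F) (K : Set State) : UpperSemicontinuousOn (totalReturn β F) (pathsFrom Γ K) := by
  have h : UpperSemicontinuousOn
      (fun x => ⨅ T, partialReturn β F x T + ((β ^ T * b (x T) : ℝ) : EReal)) (pathsFrom Γ K) := by
    refine upperSemicontinuousOn_iInf fun T => ContinuousOn.upperSemicontinuousOn fun x hx => ?_
    refine tendsto_add_of_ne_top (continuousOn_partialReturn hβ hF h5 K T x hx) ?_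
      (partialReturn_ne_top hβ hF x T) (EReal.coe_ne_top _)
    exact EReal.tendsto_coe.2 ((continuous_const.mul
      (hb.continuous.comp (continuous_apply T))).continuousWithinAt (s := pathsFrom Γ K))
  intro x hx c hc
  rw [hb.totalReturn_eq hβ ⟨rfl, hx.2⟩] at hc
  filter_upwards [h x hx c hc, self_mem_nhdsWithin] with y hy hyP
  rwa [hb.totalReturn_eq hβ ⟨rfl, hyP.2⟩]

/-! ### The value function -/

lemma totalReturn_le_value {x₀ : State} {x : ℕ → State} (hx : x ∈ feasible Γ x₀) :
    totalReturn β F x ≤ value β Γ F x₀ :=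
  le_sSup (mem_image_of_mem _ hx)

lemma IsBound.exists_optimal (hb : IsBound β Γ F b) (hβ : 0 < β) (hF : ∀ p, F p ≠ ⊤)
    (h1 : A1 Γ) (h5 : A5 Γ F) (x₀ : State) :
    ∃ x ∈ feasible Γ x₀, totalReturn β F x = value β Γ F x₀ := by
  -- `feasible Γ x₀` and `pathsFrom Γ {x₀}` agree definitionally.
  obtain ⟨x, hx, hmax⟩ := UpperSemicontinuousOn.exists_isMaxOn (feasible_nonempty h1 x₀)
    (isCompact_pathsFrom h1 isCompact_singleton) (hb.upperSemicontinuousOn hβ hF h5 {x₀})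
  refine ⟨x, hx, le_antisymm (totalReturn_le_value hx) (sSup_le ?_)⟩
  rintro _ ⟨y, hy, rfl⟩
  exact hmax hy

lemma IsBound.value_le (hb : IsBound β Γ F b) (hβ : 0 < β) (x₀ : State) :
    value β Γ F x₀ ≤ b x₀ := by
  refine sSup_le ?_
  rintro _ ⟨x, hx, rfl⟩
  exact hb.totalReturn_le hβ hx

lemma IsBound.value_ne_top (hb : IsBound β Γ F b) (hβ : 0 < β) (x₀ : State) :
    value β Γ F x₀ ≠ ⊤ :=
  ((hb.value_le hβ x₀).trans_lt (EReal.coe_lt_top _)).ne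

/-- Prepend `x` to an optimal path from `y`. -/
lemma IsBound.le_value (hb : IsBound β Γ F b) (hβ : 0 < β) (hF : ∀ p, F p ≠ ⊤)
    (h1 : A1 Γ) (h5 : A5 Γ F) {x y : State} (hy : y ∈ Γ x) :
    F (x, y) + (β : EReal) * value β Γ F y ≤ value β Γ F x := by
  obtain ⟨z, hz, hzV⟩ := hb.exists_optimal hβ hF h1 h5 y
  have hc := consPath_mem hy hz
  have h := hb.totalReturn_eq_add hβ hF hc
  rw [shift_consPath, hzV] at h
  have h' : consPath x z 1 = y := hz.1
  rw [h'] at h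
  exact h ▸ totalReturn_le_value hc

lemma IsBound.solvesBellman (hb : IsBound β Γ F b) (hβ : 0 < β) (hF : ∀ p, F p ≠ ⊤)
    (h1 : A1 Γ) (h5 : A5 Γ F) : SolvesBellman β Γ F (value β Γ F) := by
  intro x₀
  refine le_antisymm ?_ (sSup_le ?_)
  · obtain ⟨x, hx, hxV⟩ := hb.exists_optimal hβ hF h1 h5 x₀
    rw [← hxV, hb.totalReturn_eq_add hβ hF hx]
    have hx1 : x 1 ∈ Γ x₀ := hx.1 ▸ hx.2 0
    refine le_trans ?_ (le_sSup ⟨x 1, hx1, rfl⟩)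
    gcongr
    exact totalReturn_le_value (shift_mem_feasible hx 1)
  · rintro _ ⟨y, hy, rfl⟩
    exact hb.le_value hβ hF h1 h5 hy

/-- Among paths from a compact neighbourhood of `x₀`, those with `J ≥ c` form a compact set, so
their initial states form a closed set missing `x₀`. As the value is attained, nearby states outside
this set have value below `c`. -/
lemma IsBound.value_usc (hb : IsBound β Γ F b) (hβ : 0 < β) (hF : ∀ p, F p ≠ ⊤)
    (h1 : A1 Γ) (h5 : A5 Γ F) : UpperSemicontinuous (value β Γ F) := by
  intro x₀ c hc
  obtain ⟨K, hK, hxK⟩ := exists_compact_mem_nhds x₀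
  have hP := (hb.upperSemicontinuousOn hβ hF h5 K).isCompact_inter_preimage_Ici
    (isCompact_pathsFrom h1 hK) c
  have hcl : IsClosed ((fun x : ℕ → State => x 0) ''
      (pathsFrom Γ K ∩ totalReturn β F ⁻¹' Ici c)) := (hP.image (continuous_apply 0)).isClosed
  have hx₀ : x₀ ∉ (fun x : ℕ → State => x 0) ''
      (pathsFrom Γ K ∩ totalReturn β F ⁻¹' Ici c) := by
    rintro ⟨x, ⟨hxP, hxc⟩, rfl⟩
    exact (hc.trans_le (hxc.trans (totalReturn_le_value (x₀ := x 0) ⟨rfl, hxP.2⟩))).false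
  filter_upwards [hxK, hcl.isOpen_compl.mem_nhds hx₀] with z hzK hz
  obtain ⟨x, hx, hxV⟩ := hb.exists_optimal hβ hF h1 h5 z
  by_contra hcz
  exact hz ⟨x, ⟨⟨hx.1 ▸ hzK, hx.2⟩, (not_lt.1 hcz).trans_eq hxV.symm⟩, hx.1⟩

/-! ### Paths with finite returns and the limit conditions (S1), (S2) -/

lemma partialReturn_ne_bot (hb : IsBound β Γ F b) (hβ : 0 < β) (hF : ∀ p, F p ≠ ⊤)
    {x₀ : State} {x : ℕ → State} (hx : x ∈ feasibleFinite β Γ F x₀) (T : ℕ) :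
    partialReturn β F x T ≠ ⊥ := by
  have h := hx.2.ne'
  rw [hb.totalReturn_split hβ hF hx.1 T] at h
  exact (EReal.add_ne_bot_iff.1 h).1

lemma shift_mem_feasibleFinite (hb : IsBound β Γ F b) (hβ : 0 < β) (hF : ∀ p, F p ≠ ⊤)
    {x₀ : State} {x : ℕ → State} (hx : x ∈ feasibleFinite β Γ F x₀) (n : ℕ) :
    (fun t => x (n + t)) ∈ feasibleFinite β Γ F (x n) := by
  refine ⟨shift_mem_feasible hx.1 n, bot_lt_iff_ne_bot.2 fun hbot => ?_⟩
  have h := hx.2.ne'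
  rw [hb.totalReturn_split hβ hF hx.1 n, hbot, EReal.coe_mul_bot_of_pos (pow_pos hβ n)] at h
  simp at h

lemma IsBound.value_s1 (hb : IsBound β Γ F b) (hβ : 0 < β) {x₀ : State} {x : ℕ → State}
    (hx : x ∈ feasible Γ x₀) :
    limsup (fun t : ℕ => ((β ^ t : ℝ) : EReal) * value β Γ F (x t)) atTop ≤ 0 := by
  have h : Tendsto (fun t => ((β ^ t * b (x t) : ℝ) : EReal)) atTop (𝓝 0) :=
    EReal.tendsto_coe.2 (hb.decay _ x hx)
  rw [← h.limsup_eq]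
  refine limsup_le_limsup (Eventually.of_forall fun t => ?_)
  dsimp only
  rw [EReal.coe_mul]
  exact coe_mul_le_coe_mul (pow_pos hβ t).le (hb.value_le hβ _)

/-- `β ^ T * V (x T)` lies between the tail `j - p T` of the convergent series and `β ^ T * b (x
T)`; both tend to `0`. -/
lemma IsBound.value_s2 (hb : IsBound β Γ F b) (hβ : 0 < β) (hF : ∀ p, F p ≠ ⊤)
    {x₀ : State} {x : ℕ → State} (hx : x ∈ feasibleFinite β Γ F x₀) :
    Tendsto (fun t : ℕ => ((β ^ t : ℝ) : EReal) * value β Γ F (x t)) atTop (𝓝 0) := by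
  have hup : Tendsto (fun t => ((β ^ t * b (x t) : ℝ) : EReal)) atTop (𝓝 0) :=
    EReal.tendsto_coe.2 (hb.decay _ x hx.1)
  obtain ⟨j, hj⟩ : ∃ j : ℝ, totalReturn β F x = j :=
    ⟨_, (EReal.coe_toReal (hb.totalReturn_ne_top hβ hx.1) hx.2.ne').symm⟩
  have hp : ∀ T, ∃ p : ℝ, partialReturn β F x T = p := fun T =>
    ⟨_, (EReal.coe_toReal (partialReturn_ne_top hβ hF x T)
      (partialReturn_ne_bot hb hβ hF hx T)).symm⟩
  choose p hp using hp
  have hlim : Tendsto p atTop (𝓝 j) := by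
    have h := hb.tendsto hβ hx.1
    rw [hj, funext hp] at h
    exact EReal.tendsto_coe.1 h
  have hlow : Tendsto (fun T => ((j - p T : ℝ) : EReal)) atTop (𝓝 0) :=
    EReal.tendsto_coe.2 (by simpa using hlim.const_sub j)
  refine tendsto_of_tendsto_of_tendsto_of_le_of_le hlow hup (fun T => ?_) fun T => ?_
  · have h := hb.totalReturn_split hβ hF hx.1 T
    rw [hj, hp] at h
    dsimp only
    rw [EReal.coe_sub, h, EReal.add_sub_cancel_left]
    exact coe_mul_le_coe_mul (pow_pos hβ T).le (totalReturn_le_value (shift_mem_feasible hx.1 T))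
  · dsimp only
    rw [EReal.coe_mul]
    exact coe_mul_le_coe_mul (pow_pos hβ T).le (hb.value_le hβ _)

lemma IsBound.memS (hb : IsBound β Γ F b) (hβ : 0 < β) (hF : ∀ p, F p ≠ ⊤)
    (h1 : A1 Γ) (h5 : A5 Γ F) : MemS β Γ F (value β Γ F) where
  ne_top := hb.value_ne_top hβ
  usc := hb.value_usc hβ hF h1 h5
  s1 _ _ hx := hb.value_s1 hβ hx
  s2 _ _ hx := hb.value_s2 hβ hF hx

/-! ### Uniqueness -/

lemma SolvesBellman.le_step {W : State → EReal} (hW : SolvesBellman β Γ F W) {x y : State}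
    (hy : y ∈ Γ x) : F (x, y) + (β : EReal) * W y ≤ W x := by
  conv_rhs => rw [hW x]
  exact le_sSup ⟨y, hy, rfl⟩

lemma SolvesBellman.partialReturn_add_le {W : State → EReal} (hW : SolvesBellman β Γ F W)
    (hβ : 0 < β) {x₀ : State} {x : ℕ → State} (hx : x ∈ feasible Γ x₀) (T : ℕ) :
    partialReturn β F x T + ((β ^ T : ℝ) : EReal) * W (x T) ≤ W x₀ := by
  induction T with
  | zero => simp [partialReturn_zero, hx.1]
  | succ T ih =>
    refine le_trans ?_ ih
    have h := coe_mul_le_coe_mul (pow_pos hβ T).le (hW.le_step (hx.2 T))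
    rw [coe_mul_add (pow_pos hβ T).le, ← mul_assoc, ← EReal.coe_mul, ← pow_succ] at h
    rw [partialReturn_succ, add_assoc]
    gcongr

/-- The right-hand side of the Bellman equation is upper semicontinuous in `y` on the compact set `Γ
x`, so its supremum is attained. -/
lemma MemS.exists_greedy {W : State → EReal} (hS : MemS β Γ F W) (hW : SolvesBellman β Γ F W)
    (hβ : 0 < β) (hF : ∀ p, F p ≠ ⊤) (h1 : A1 Γ) (h5 : A5 Γ F) (x : State) :
    ∃ y ∈ Γ x, W x = F (x, y) + (β : EReal) * W y := by
  have hβW : UpperSemicontinuous fun y => (β : EReal) * W y := by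
    refine Continuous.comp_upperSemicontinuous (g := fun v : EReal => (β : EReal) * v)
      ?_ hS.usc fun a b h => coe_mul_le_coe_mul hβ.le h
    exact continuous_iff_continuousAt.2 fun v => tendsto_coe_mul β tendsto_id
  have hne : ∀ y, (β : EReal) * W y ≠ ⊤ := fun y => by
    simpa using coe_pow_mul_ne_top hβ (hS.ne_top y) 1
  have hFx : ContinuousOn (fun y => F (x, y)) (Γ x) :=
    h5.continuousOn.comp (f := fun y => (x, y)) (by fun_prop) fun y hy => hy
  have husc : UpperSemicontinuousOn (fun y => F (x, y) + (β : EReal) * W y) (Γ x) :=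
    hFx.upperSemicontinuousOn.add' (hβW.upperSemicontinuousOn _) fun y _ =>
      EReal.continuousAt_add (.inl (hF _)) (.inr (hne y))
  obtain ⟨y, hy, hmax⟩ := husc.exists_isMaxOn (h1.nonempty x) (h1.compact x)
  refine ⟨y, hy, le_antisymm ?_ (hW.le_step hy)⟩
  conv_lhs => rw [hW x]
  refine sSup_le ?_
  rintro _ ⟨z, hz, rfl⟩
  exact hmax hz

lemma IsBound.unique (hb : IsBound β Γ F b) (hβ : 0 < β) (hF : ∀ p, F p ≠ ⊤)
    (h1 : A1 Γ) (h5 : A5 Γ F) {W : State → EReal} (hS : MemS β Γ F W)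
    (hW : SolvesBellman β Γ F W) : W = value β Γ F := by
  funext x₀
  refine le_antisymm ?_ (sSup_le ?_)
  -- Along a path of maximizing successors the Bellman equation iterates with equality, and (S1)
  -- bounds the remainder.
  · obtain ⟨x, hx0, hx⟩ := exists_path_of_step
      (R := fun x y => y ∈ Γ x ∧ W x = F (x, y) + (β : EReal) * W y)
      (fun x => hS.exists_greedy hW hβ hF h1 h5 x) x₀
    have hxf : x ∈ feasible Γ x₀ := ⟨hx0, fun t => (hx t).1⟩
    have heq : ∀ T, W x₀ = partialReturn β F x T + ((β ^ T : ℝ) : EReal) * W (x T) := by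
      intro T
      induction T with
      | zero => simp [partialReturn_zero, hx0]
      | succ T ih =>
        rw [ih, (hx T).2, coe_mul_add (pow_pos hβ T).le, ← mul_assoc, ← EReal.coe_mul, ← pow_succ,
          partialReturn_succ, add_assoc]
    have hs := hS.s1 x₀ x hxf
    have hne : limsup (fun t : ℕ => ((β ^ t : ℝ) : EReal) * W (x t)) atTop ≠ ⊤ :=
      (hs.trans_lt EReal.zero_lt_top).ne
    calc W x₀ = limsup (partialReturn β F x + fun t : ℕ => ((β ^ t : ℝ) : EReal) * W (x t))
          atTop := by
          rw [show (partialReturn β F x + fun t : ℕ => ((β ^ t : ℝ) : EReal) * W (x t)) =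
            fun _ => W x₀ from funext fun T => (heq T).symm, limsup_const]
      _ ≤ totalReturn β F x + limsup (fun t : ℕ => ((β ^ t : ℝ) : EReal) * W (x t)) atTop :=
          EReal.limsup_add_le (.inr hne) (.inl (hb.totalReturn_ne_top hβ hxf))
      _ ≤ totalReturn β F x + 0 := by gcongr
      _ ≤ value β Γ F x₀ := by rw [add_zero]; exact totalReturn_le_value hxf
  -- Paths with `J = ⊥` are trivial; along the others (S2) removes the remainder from the iterated
  -- inequality.
  · rintro _ ⟨x, hx, rfl⟩
    rcases eq_or_ne (totalReturn β F x) ⊥ with h | h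
    · simp [h]
    · have hlim := tendsto_add_of_ne_top (hb.tendsto hβ hx)
        (hS.s2 x₀ x ⟨hx, bot_lt_iff_ne_bot.2 h⟩) (hb.totalReturn_ne_top hβ hx) EReal.zero_ne_top
      rw [add_zero] at hlim
      exact le_of_tendsto' hlim fun T => hW.partialReturn_add_le hβ hx T

end Bound

end GrowthModel

namespace GrowthModel

/-! ### The dominating function obtained from the growth conditions -/

variable {β : ℝ} {Γ : State → Set State} {F : State × State → EReal}

lemma continuous_seminorm_prod (N : Seminorm ℝ (ℝ × ℝ)) : Continuous N := by
  refine Seminorm.continuous_of_le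
    (q := (‖N (1, 0) + N (0, 1)‖₊) • normSeminorm ℝ (ℝ × ℝ)) ?_ fun v => ?_
  · exact continuous_const.mul continuous_norm
  · have hv : v = v.1 • ((1, 0) : ℝ × ℝ) + v.2 • ((0, 1) : ℝ × ℝ) := by ext <;> simp
    have h1 := apply_nonneg N (1, 0)
    have h2 := apply_nonneg N (0, 1)
    calc N v ≤ ‖v.1‖ * N (1, 0) + ‖v.2‖ * N (0, 1) := by
          conv_lhs => rw [hv]
          refine (map_add_le_add N _ _).trans_eq ?_
          rw [map_smul_eq_mul, map_smul_eq_mul]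
      _ ≤ ‖v‖ * N (1, 0) + ‖v‖ * N (0, 1) := by
          gcongr
          · exact norm_fst_le v
          · exact norm_snd_le v
      _ = ‖N (1, 0) + N (0, 1)‖ * ‖v‖ := by
          rw [Real.norm_of_nonneg (add_nonneg h1 h2)]; ring

lemma continuous_toPlane : Continuous toPlane := by
  unfold toPlane
  fun_prop

/-- With `m = N + K + 1`, feasible steps multiply `m` by at most `γ`, and current returns are at
most `C (1 - βγ) m`. Hence `b = C m` satisfies `F + β b(y) ≤ C (1 - βγ) m + βγ C m = b`, and `βγ <
1` gives the decay. -/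
lemma exists_isBound {N : Seminorm ℝ (ℝ × ℝ)} {ζ ζ' : ℝ} (hβ : 0 < β) (hβ1 : β < 1)
    (h2 : A2 N Γ ζ ζ') (h3 : A3 N Γ F) (h4 : A4 β ζ) : ∃ b, IsBound β Γ F b := by
  obtain ⟨η, η', hη, hη', hF⟩ := h3
  -- The growth factor is raised above `1` if necessary, to the midpoint of `1` and `1 / β`, so that
  -- `K` below is well defined and nonnegative.
  obtain ⟨γ, hγ1, hζγ, hβγ⟩ : ∃ γ, 1 < γ ∧ ζ ≤ γ ∧ β * γ < 1 := by
    have hζ : β * ζ < 1 := by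
      rcases h2.nonneg.eq_or_lt with h | h
      · simp [← h]
      · exact h4 h
    refine ⟨max ζ ((1 + 1 / β) / 2), lt_max_of_lt_right ?_, le_max_left _ _, ?_⟩
    · have : 1 < 1 / β := by rwa [lt_div_iff₀ hβ, one_mul]
      linarith
    · rw [mul_max_of_nonneg _ _ hβ.le]
      refine max_lt hζ ?_
      have : β * ((1 + 1 / β) / 2) = (β + 1) / 2 := by field_simp
      linarith
  -- This shift absorbs `ζ'`: it solves `ζ' + K = γ * K`.
  set K := ζ' / (γ - 1) with hK
  have hK0 : 0 ≤ K := div_nonneg h2.nonneg' (by linarith)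
  have hKζ : ζ' + K = γ * K := by
    have : γ - 1 ≠ 0 := by linarith
    rw [hK]; field_simp; ring
  set n : State → ℝ := fun x => N (toPlane x) with hn
  have hn0 : ∀ x, 0 ≤ n x := fun x => apply_nonneg N _
  set C := (η * (1 + ζ) + η * ζ' + η') / (1 - β * γ) with hC
  have hρ : 0 < 1 - β * γ := by linarith
  have hζ0 := h2.nonneg
  have hζ0' := h2.nonneg'
  have hC0 : 0 ≤ C := by positivity
  have hCρ : η * (1 + ζ) + η * ζ' + η' = C * (1 - β * γ) := by
    rw [hC]; field_simp
  have hgrow : ∀ x, ∀ y ∈ Γ x, n y + K + 1 ≤ γ * (n x + K + 1) := by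
    intro x y hy
    have h1 := h2.bound x y hy
    have h2 := mul_le_mul_of_nonneg_right hζγ (hn0 x)
    simp only [hn] at h2 ⊢
    nlinarith
  refine ⟨fun x => C * (n x + K + 1), ?_, ?_, ?_⟩
  · exact continuous_const.mul ((((continuous_seminorm_prod N).comp continuous_toPlane).add
      continuous_const).add continuous_const)
  · intro x y hy
    have hle := hF x y hy
    calc F (x, y) + ((β * (C * (n y + K + 1)) : ℝ) : EReal)
        ≤ ((η * (n x + n y) + η' : ℝ) : EReal) + ((β * (C * (n y + K + 1)) : ℝ) : EReal) := by
          gcongr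
      _ ≤ ((C * (n x + K + 1) : ℝ) : EReal) := by
          rw [← EReal.coe_add, EReal.coe_le_coe_iff]
          have h1 : n y ≤ ζ * n x + ζ' := h2.bound x y hy
          have e1 : η * (n x + n y) + η' ≤
              (η * (1 + ζ) + η * ζ' + η') * (n x + K + 1) := by
            have a1 : η * n y ≤ η * (ζ * n x + ζ') := mul_le_mul_of_nonneg_left h1 hη
            have a2 : 0 ≤ η * (1 + ζ) * (K + 1) := by positivity
            have a3 : 0 ≤ (η * ζ' + η') * (n x + K) :=
              mul_nonneg (by positivity) (add_nonneg (hn0 x) hK0)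
            nlinarith
          have e2 : β * (C * (n y + K + 1)) ≤ β * (C * (γ * (n x + K + 1))) := by
            have := hgrow x y hy
            gcongr
          rw [hCρ] at e1
          nlinarith
  · intro x₀ x hx
    have hdec : ∀ t, β ^ t * (C * (n (x t) + K + 1)) ≤ (β * γ) ^ t * (C * (n (x 0) + K + 1)) := by
      intro t
      have : n (x t) + K + 1 ≤ γ ^ t * (n (x 0) + K + 1) := by
        induction t with
        | zero => simp
        | succ t ih =>
          refine (hgrow _ _ (hx.2 t)).trans ?_
          rw [pow_succ', mul_assoc]
          gcongr
      rw [mul_pow]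
      calc β ^ t * (C * (n (x t) + K + 1)) ≤ β ^ t * (C * (γ ^ t * (n (x 0) + K + 1))) := by
            gcongr
        _ = _ := by ring
    refine squeeze_zero (fun t => ?_) hdec ?_
    · have := hn0 (x t)
      positivity
    · simpa using (tendsto_pow_atTop_nhds_zero_of_lt_one (by positivity) hβγ).mul_const
        (C * (n (x 0) + K + 1))

/-! ### Continuity of the value function -/

variable {b : State → ℝ}

lemma IsBound.return_ne_bot (hb : IsBound β Γ F b) (hβ : 0 < β) (hF : ∀ p, F p ≠ ⊤)
    {x₀ : State} {x : ℕ → State} (hx : x ∈ feasibleFinite β Γ F x₀) (t : ℕ) :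
    F (x t, x (t + 1)) ≠ ⊥ := by
  intro h
  refine partialReturn_ne_bot hb hβ hF hx (t + 1) ?_
  rw [partialReturn_succ, h, EReal.coe_mul_bot_of_pos (pow_pos hβ t), EReal.add_bot]

/-- Scale an optimal path from `y` by `l` and sum (A6b) over dates; the terms `Φ₂ l` add up to a
geometric series. Returns along the path are real, so the sign of `Φ₁ l` plays no role. -/
lemma IsBound.le_value_smul (hb : IsBound β Γ F b) (hβ : 0 < β) (hβ1 : β < 1)
    (hF : ∀ p, F p ≠ ⊤) (h1 : A1 Γ) (h5 : A5 Γ F)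
    (h6 : ∀ p ∈ graph Γ, ∀ l : ℝ≥0, 0 < l → l ≤ 1 → l • p ∈ graph Γ) {Φ₁ Φ₂ : ℝ≥0 → ℝ}
    (hΦ : ∀ p ∈ graph Γ, F p ≠ ⊥ → ∀ l : ℝ≥0, 0 < l → l ≤ 1 →
      (Φ₁ l : EReal) * F p + (Φ₂ l : EReal) ≤ F (l • p))
    {y : State} {v : ℝ} (hv : value β Γ F y = v) {l : ℝ≥0} (hl : 0 < l) (hl1 : l ≤ 1) :
    ((Φ₁ l * v + Φ₂ l * (1 - β)⁻¹ : ℝ) : EReal) ≤ value β Γ F (l • y) := by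
  obtain ⟨x, hx, hxV⟩ := hb.exists_optimal hβ hF h1 h5 y
  rw [hv] at hxV
  have hxf : x ∈ feasibleFinite β Γ F y := ⟨hx, hxV ▸ EReal.bot_lt_coe v⟩
  have hlx : (fun t => l • x t) ∈ feasible Γ (l • y) :=
    ⟨by simp [hx.1], fun t => h6 (x t, x (t + 1)) (hx.2 t) l hl hl1⟩
  have hf : ∀ t, ∃ f : ℝ, F (x t, x (t + 1)) = f := fun t =>
    ⟨_, (EReal.coe_toReal (hF _) (hb.return_ne_bot hβ hF hxf t)).symm⟩
  choose f hf using hf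
  have hle : ∀ T, ((Φ₁ l * (∑ t ∈ Finset.range T, β ^ t * f t) +
      Φ₂ l * ∑ t ∈ Finset.range T, β ^ t : ℝ) : EReal) ≤
        partialReturn β F (fun t => l • x t) T := by
    intro T
    induction T with
    | zero => simp [partialReturn_zero]
    | succ T ih =>
      have h := coe_mul_le_coe_mul (pow_pos hβ T).le
        (hΦ (x T, x (T + 1)) (hx.2 T) (hb.return_ne_bot hβ hF hxf T) l hl hl1)
      rw [hf, ← EReal.coe_mul, ← EReal.coe_add, ← EReal.coe_mul] at h
      rw [partialReturn_succ, Finset.sum_range_succ, Finset.sum_range_succ]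
      refine le_trans (le_of_eq ?_) (add_le_add ih h)
      rw [← EReal.coe_add]
      congr 1
      ring
  have hlim : Tendsto (fun T => ((Φ₁ l * (∑ t ∈ Finset.range T, β ^ t * f t) +
      Φ₂ l * ∑ t ∈ Finset.range T, β ^ t : ℝ) : EReal)) atTop
      (𝓝 ((Φ₁ l * v + Φ₂ l * (1 - β)⁻¹ : ℝ) : EReal)) := by
    refine EReal.tendsto_coe.2 (Tendsto.add (Tendsto.const_mul _ ?_) (Tendsto.const_mul _ ?_))
    · have h := hb.tendsto hβ hx
      rw [hxV, funext (partialReturn_eq_coe hf)] at h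
      exact EReal.tendsto_coe.1 h
    · exact (hasSum_geometric_of_lt_one hβ.le hβ1).tendsto_sum_nat
  exact (le_of_tendsto_of_tendsto' hlim (hb.tendsto hβ hlx) hle).trans (totalReturn_le_value hlx)

lemma IsBound.value_lsc (hb : IsBound β Γ F b) (hβ : 0 < β) (hβ1 : β < 1)
    (hF : ∀ p, F p ≠ ⊤) (h1 : A1 Γ) (h5 : A5 Γ F) (h6 : A6 Γ F) {x₀ : State}
    (hV : value β Γ F x₀ ≠ ⊥) : LowerSemicontinuousAt (value β Γ F) x₀ := by
  intro c hc
  obtain ⟨Φ₁, Φ₂, hΦ₁, hΦ₂, hΦ₁1, hΦ₂1, hΦ⟩ := h6.b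
  obtain ⟨x, hx, hxV⟩ := hb.exists_optimal hβ hF h1 h5 x₀
  have hxf : x ∈ feasibleFinite β Γ F x₀ := ⟨hx, hxV ▸ bot_lt_iff_ne_bot.2 hV⟩
  set y := x 1 with hy
  have hyΓ : y ∈ Γ x₀ := hx.1 ▸ hx.2 0
  have hFb : F (x₀, y) ≠ ⊥ := by simpa [hx.1] using hb.return_ne_bot hβ hF hxf 0
  have hyb : value β Γ F y ≠ ⊥ :=
    ((shift_mem_feasibleFinite hb hβ hF hxf 1).2.trans_le
      (totalReturn_le_value (shift_mem_feasible hx 1))).ne'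
  obtain ⟨f, hf⟩ : ∃ f : ℝ, F (x₀, y) = f := ⟨_, (EReal.coe_toReal (hF _) hFb).symm⟩
  obtain ⟨v, hv⟩ : ∃ v : ℝ, value β Γ F y = v :=
    ⟨_, (EReal.coe_toReal (hb.value_ne_top hβ y) hyb).symm⟩
  have hVle : value β Γ F x₀ ≤ ((f + β * v : ℝ) : EReal) := by
    rw [← hxV, hb.totalReturn_eq_add hβ hF hx, hf, EReal.coe_add, EReal.coe_mul, ← hv]
    exact add_le_add_right (coe_mul_le_coe_mul hβ.le
      (totalReturn_le_value (shift_mem_feasible hx 1))) _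
  obtain ⟨c', hcc', hc'⟩ := EReal.lt_iff_exists_real_btwn.1 (hc.trans_le hVle)
  rw [EReal.coe_lt_coe_iff] at hc'
  -- The slack is split equally between the current return and the continuation value.
  set δ := (f + β * v - c') / 2 with hδ
  have hδ0 : 0 < δ := by rw [hδ]; linarith
  have hsub : Tendsto (fun ε : ℝ≥0 => 1 - ε) (𝓝[>] 0) (𝓝 1) := by
    have : Continuous fun ε : ℝ≥0 => 1 - ε := by fun_prop
    simpa using (this.tendsto 0).mono_left nhdsWithin_le_nhds
  have hpos : ∀ᶠ ε : ℝ≥0 in 𝓝[>] 0, 0 < ε ∧ ε < 1 := by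
    filter_upwards [self_mem_nhdsWithin, nhdsWithin_le_nhds (Iio_mem_nhds zero_lt_one)]
      with ε h h' using ⟨h, h'⟩
  have hsub' : Tendsto (fun ε : ℝ≥0 => 1 - ε) (𝓝[>] 0) (𝓝[Ioc 0 1] 1) := by
    refine tendsto_nhdsWithin_iff.2 ⟨hsub, ?_⟩
    filter_upwards [hpos] with ε hε
    exact ⟨tsub_pos_of_lt hε.2, tsub_le_self⟩
  have hΦlim : Tendsto (fun ε : ℝ≥0 => β * (Φ₁ (1 - ε) * v + Φ₂ (1 - ε) * (1 - β)⁻¹))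
      (𝓝[>] 0) (𝓝 (β * v)) := by
    have a1 : Tendsto (fun ε : ℝ≥0 => Φ₁ (1 - ε)) (𝓝[>] 0) (𝓝 1) :=
      hΦ₁1 ▸ (hΦ₁ 1 ⟨zero_lt_one, le_rfl⟩).tendsto.comp hsub'
    have a2 : Tendsto (fun ε : ℝ≥0 => Φ₂ (1 - ε)) (𝓝[>] 0) (𝓝 0) :=
      hΦ₂1 ▸ (hΦ₂ 1 ⟨zero_lt_one, le_rfl⟩).tendsto.comp hsub'
    simpa using ((a1.mul_const v).add (a2.mul_const (1 - β)⁻¹)).const_mul β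
  have hFev : ∀ᶠ p in 𝓝 (x₀, y), p ∈ graph Γ → ((f - δ : ℝ) : EReal) < F p := by
    have h := (h5.continuous (x₀, y) hyΓ hFb).eventually_const_lt
      (u := ((f - δ : ℝ) : EReal)) (by rw [hf, EReal.coe_lt_coe_iff]; linarith)
    exact eventually_nhdsWithin_iff.1 h
  rw [nhds_prod_eq] at hFev
  obtain ⟨p, hp, q, hq, hpq⟩ := eventually_prod_iff.1 hFev
  have hlam : Tendsto (fun ε : ℝ≥0 => (1 - ε) • y) (𝓝[>] 0) (𝓝 y) := by
    simpa using hsub.smul_const y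
  obtain ⟨ε₀, hε₀, -, hc6⟩ := h6.c x₀ y hyΓ
  have hsmall : ∀ᶠ ε : ℝ≥0 in 𝓝[>] 0, ε < ε₀ := nhdsWithin_le_nhds (Iio_mem_nhds hε₀)
  -- `ε` is fixed before `z` varies, since the neighbourhood in (A6c) depends on it.
  obtain ⟨ε, hεq, hεΦ, hεlt, hε0, hε1⟩ := ((hlam.eventually hq).and
    ((hΦlim.eventually_const_lt (show β * v - δ < β * v by linarith)).and
      (hsmall.and hpos))).exists
  have hle := hb.le_value_smul hβ hβ1 hF h1 h5 h6.a hΦ hv (tsub_pos_of_lt hε1)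
    (tsub_le_self (b := ε))
  filter_upwards [hp, hc6 ε hε0 hεlt] with z hz hzΓ
  calc c < (c' : EReal) := hcc'
    _ = ((f - δ : ℝ) : EReal) + ((β * v - δ : ℝ) : EReal) := by
      rw [← EReal.coe_add]; congr 1; rw [hδ]; ring
    _ ≤ F (z, (1 - ε) • y) + (β : EReal) * value β Γ F ((1 - ε) • y) := by
      refine add_le_add (hpq hz hεq hzΓ).le ?_
      refine le_trans ?_ (coe_mul_le_coe_mul hβ.le hle)
      rw [← EReal.coe_mul, EReal.coe_le_coe_iff]
      exact hεΦ.le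
    _ ≤ value β Γ F z := hb.le_value hβ hF h1 h5 hzΓ

lemma IsBound.continuousAt_value (hb : IsBound β Γ F b) (hβ : 0 < β) (hβ1 : β < 1)
    (hF : ∀ p, F p ≠ ⊤) (h1 : A1 Γ) (h5 : A5 Γ F) (h6 : A6 Γ F) {x₀ : State} {x : ℕ → State}
    (hx : x ∈ feasibleFinite β Γ F x₀) (t : ℕ) : ContinuousAt (value β Γ F) (x t) := by
  refine continuousAt_iff_lower_upperSemicontinuousAt.2
    ⟨hb.value_lsc hβ hβ1 hF h1 h5 h6 ?_, hb.value_usc hβ hF h1 h5 (x t)⟩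
  have h := shift_mem_feasibleFinite hb hβ hF hx t
  exact (h.2.trans_le (totalReturn_le_value h.1)).ne'

lemma tendsto_bot_of_upperSemicontinuous {W : State → EReal} (hW : UpperSemicontinuous W)
    {x₀ : State} (h : W x₀ = ⊥) : Tendsto W (𝓝 x₀) (𝓝 ⊥) :=
  tendsto_order.2 ⟨fun _ ha => absurd ha not_lt_bot, fun a ha => hW x₀ a (h.trans_lt ha)⟩

end GrowthModel

namespace GrowthModel

/-! ### Isoelastic utility -/

lemma utility_of_pos_of_eq_zero {θ c : ℝ} (hc : 0 < c) (hθ : θ = 0) :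
    utility θ c = (Real.log c : ℝ) := by
  rw [utility, if_neg (by rintro (h | h) <;> linarith), if_pos hθ]

lemma utility_of_ne_zero {θ c : ℝ} (hc : ¬ (c < 0 ∨ (c = 0 ∧ θ ≤ 0))) (hθ : θ ≠ 0) :
    utility θ c = ((c ^ θ - 1) / θ : ℝ) := by
  rw [utility, if_neg hc, if_neg hθ]

/-- The hypothesis `utility θ c ≠ ⊥`, weaker than `0 < c`, also admits `c = 0` when `θ > 0`, which
(A6b) requires. -/
lemma utility_mul {θ c l : ℝ} (hc : utility θ c ≠ ⊥) (hl : 0 < l) :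
    utility θ (l * c) = ((l ^ θ : ℝ) : EReal) * utility θ c + utility θ l := by
  have hc' : ¬ (c < 0 ∨ (c = 0 ∧ θ ≤ 0)) := fun h => hc (by rw [utility, if_pos h])
  obtain ⟨h0, h1⟩ := not_or.1 hc'
  have hc0 := not_lt.1 h0
  rcases eq_or_ne θ 0 with hθ | hθ
  · have hcpos : 0 < c := hc0.lt_of_ne fun h => h1 ⟨h.symm, hθ.le⟩
    rw [utility_of_pos_of_eq_zero (mul_pos hl hcpos) hθ, utility_of_pos_of_eq_zero hcpos hθ,
      utility_of_pos_of_eq_zero hl hθ, hθ, Real.rpow_zero, Real.log_mul hl.ne' hcpos.ne']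
    norm_cast
    ring
  · have hlc : ¬ (l * c < 0 ∨ (l * c = 0 ∧ θ ≤ 0)) := by
      rintro (h | ⟨h, h'⟩)
      · exact (mul_nonneg hl.le hc0).not_gt h
      · exact h1 ⟨(mul_eq_zero.1 h).resolve_left hl.ne', h'⟩
    rw [utility_of_ne_zero hlc hθ, utility_of_ne_zero hc' hθ,
      utility_of_ne_zero (by rintro (h | h) <;> linarith) hθ, Real.mul_rpow hl.le hc0]
    norm_cast
    ring

lemma utility_ne_bot {θ c : ℝ} (hc : 0 < c) : utility θ c ≠ ⊥ := by
  rcases eq_or_ne θ 0 with hθ | hθ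
  · rw [utility_of_pos_of_eq_zero hc hθ]; exact EReal.coe_ne_bot _
  · rw [utility_of_ne_zero (by rintro (h | h) <;> linarith) hθ]; exact EReal.coe_ne_bot _

lemma exists_utility_continuousOn (θ : ℝ) : ∃ Φ : ℝ≥0 → ℝ, ContinuousOn Φ (Ioc 0 1) ∧ Φ 1 = 0 ∧
    ∀ l : ℝ≥0, 0 < l → utility θ l = Φ l := by
  rcases eq_or_ne θ 0 with hθ | hθ
  · refine ⟨fun l => Real.log l, fun l hl => ?_, by simp, fun l hl => ?_⟩
    · exact (NNReal.continuous_coe.continuousAt.log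
        (NNReal.coe_ne_zero.2 hl.1.ne')).continuousWithinAt
    · exact utility_of_pos_of_eq_zero hl hθ
  · refine ⟨fun l => ((l : ℝ) ^ θ - 1) / θ, fun l hl => ?_, by simp, fun l hl => ?_⟩
    · exact (((NNReal.continuous_coe.continuousAt.rpow_const
        (.inl (NNReal.coe_ne_zero.2 hl.1.ne'))).sub continuousAt_const).div_const
          θ).continuousWithinAt
    · have hl' : (0 : ℝ) < l := hl
      exact utility_of_ne_zero (by rintro (h | h) <;> linarith) hθ

/-! ### The two-sector model -/

namespace Params

variable (M : Params)

lemma Dh_pos : 0 < M.Dh := by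
  have h0 : 0 < M.φ 1 := (div_pos M.δh_pos M.B_pos).trans M.φ_one
  have := mul_pos M.B_pos h0
  have := M.δh_lt
  unfold Dh
  linarith

/-- Resources available for consumption and investment. -/
noncomputable def resources (x : State) : ℝ :=
  (M.A * (x.1 : ℝ) ^ M.α * (x.2 : ℝ) ^ (1 - M.α) + (1 - M.δk) * x.1) / (1 + M.n)

lemma mem_Gam {x y : State} : y ∈ M.Gam x ↔ (y.1 : ℝ) ≤ M.resources x ∧ (y.2 : ℝ) ≤ M.Dh * x.2 :=
  Iff.rfl

lemma resources_nonneg (x : State) : 0 ≤ M.resources x := by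
  have h1 := M.A_pos
  have h2 : 0 ≤ 1 - M.δk := by linarith [M.δk_lt]
  have h3 := M.n_nonneg
  unfold resources
  positivity

lemma rpow_mul_rpow_homogeneous {l : ℝ} (hl : 0 < l) {k h : ℝ} (hk : 0 ≤ k) (hh : 0 ≤ h) :
    (l * k) ^ M.α * (l * h) ^ (1 - M.α) = l * (k ^ M.α * h ^ (1 - M.α)) := by
  have : l ^ M.α * l ^ (1 - M.α) = l := by rw [← Real.rpow_add hl]; simp
  rw [Real.mul_rpow hl.le hk, Real.mul_rpow hl.le hh]
  linear_combination (k ^ M.α * h ^ (1 - M.α)) * this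

lemma resources_smul {l : ℝ≥0} (hl : 0 < l) (x : State) :
    M.resources (l • x) = l * M.resources x := by
  have h := M.rpow_mul_rpow_homogeneous (NNReal.coe_pos.2 hl) x.1.coe_nonneg x.2.coe_nonneg
  simp only [resources, Prod.smul_fst, Prod.smul_snd, smul_eq_mul, NNReal.coe_mul]
  linear_combination (M.A / (1 + M.n)) * h

lemma continuous_resources : Continuous M.resources := by
  have h1 := M.α_pos
  have h2 : 0 < 1 - M.α := by linarith [M.α_lt]
  unfold resources
  refine Continuous.div_const (Continuous.add (Continuous.mul (continuous_const.mul ?_) ?_)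
    (by fun_prop)) _
  · exact (NNReal.continuous_coe.comp continuous_fst).rpow_const fun _ => .inr h1.le
  · exact (NNReal.continuous_coe.comp continuous_snd).rpow_const fun _ => .inr h2.le

lemma smul_mem_graph {p : State × State} (hp : p ∈ graph M.Gam) {l : ℝ≥0} (hl : 0 < l) :
    l • p ∈ graph M.Gam := by
  obtain ⟨h1, h2⟩ := M.mem_Gam.1 hp
  have hl' : (0 : ℝ) ≤ l := l.coe_nonneg
  refine M.mem_Gam.2 ⟨?_, ?_⟩
  · rw [Prod.smul_fst, M.resources_smul hl]
    exact mul_le_mul_of_nonneg_left h1 hl'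
  · have := mul_le_mul_of_nonneg_left h2 hl'
    simp only [Prod.smul_fst, Prod.smul_snd, smul_eq_mul, NNReal.coe_mul]
    linarith

lemma psi_mul {l : ℝ} (hl : 0 < l) (h h' : ℝ) : M.psi (l * h) (l * h') = M.psi h h' := by
  have h1 : (l * h = 0 ∨ l * h' ≤ (1 - M.δh) * (l * h)) ↔ (h = 0 ∨ h' ≤ (1 - M.δh) * h) := by
    rw [mul_eq_zero, or_iff_right hl.ne', mul_left_comm, mul_le_mul_iff_right₀ hl]
  simp only [psi, h1, mul_div_mul_left _ _ hl.ne']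

/-- Feasibility `h' ≤ D_h h` puts the argument of `φ⁻¹` in `[φ 0, φ 1]`, where by the intermediate
value theorem `invFunOn` returns a point of `[0, 1]`. Nonnegativity is what lets real powers of `psi
* h` split in `consumption_smul`. -/
lemma psi_nonneg {h h' : ℝ} (hh : 0 ≤ h) (hle : h' ≤ M.Dh * h) : 0 ≤ M.psi h h' := by
  unfold psi
  split_ifs with hc
  · exact zero_le_one
  · obtain ⟨h0, h1⟩ := not_or.1 hc
    have hpos : 0 < h := hh.lt_of_ne (Ne.symm h0)
    have hB := M.B_pos
    have hmem : (h' / h - (1 - M.δh)) / M.B ∈ Icc (M.φ 0) (M.φ 1) := by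
      rw [M.φ_zero]
      constructor
      · refine div_nonneg ?_ hB.le
        rw [sub_nonneg, le_div_iff₀ hpos]
        exact (not_le.1 h1).le
      · rw [div_le_iff₀ hB, sub_le_iff_le_add, div_le_iff₀ hpos, mul_comm (M.φ 1)]
        exact hle
    have := Function.invFunOn_mem (intermediate_value_Icc zero_le_one M.φ_cont hmem)
    linarith [this.2]

/-- Consumption. -/
noncomputable def consumption (p : State × State) : ℝ :=
  if p.1.1 = 0 ∨ p.1.2 = 0 then max 0 ((1 - M.δk) * p.1.1 - (1 + M.n) * p.2.1)
  else M.A * (p.1.1 : ℝ) ^ M.α * (M.psi p.1.2 p.2.2 * p.1.2) ^ (1 - M.α)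
      + (1 - M.δk) * p.1.1 - (1 + M.n) * p.2.1

lemma ret_eq (p : State × State) : M.ret p = utility M.θ (M.consumption p) := by
  unfold ret consumption
  split_ifs <;> rfl

lemma consumption_smul {p : State × State} (hp : p ∈ graph M.Gam) {l : ℝ≥0} (hl : 0 < l) :
    M.consumption (l • p) = l * M.consumption p := by
  have hl' : (0 : ℝ) < l := hl
  have hz : ∀ a : ℝ≥0, l * a = 0 ↔ a = 0 := fun a => by simp [hl.ne']
  simp only [consumption, Prod.smul_fst, Prod.smul_snd, smul_eq_mul, NNReal.coe_mul, hz,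
    M.psi_mul hl']
  split_ifs with hc
  · rw [mul_max_of_nonneg _ _ hl'.le, mul_zero]
    congr 1
    ring
  · have h := M.rpow_mul_rpow_homogeneous hl' p.1.1.coe_nonneg
      (mul_nonneg (M.psi_nonneg p.1.2.coe_nonneg (M.mem_Gam.1 hp).2) p.1.2.coe_nonneg)
    rw [mul_left_comm (M.psi _ _)]
    linear_combination M.A * h

/-- If `a > 0`, shrinking creates strict slack that survives small moves of the state; if `a = 0`,
nonnegativity of `f` is enough. -/
lemma eventually_one_sub_mul_le {f : State → ℝ} (hf : Continuous f) (hf0 : ∀ x, 0 ≤ f x) {x : State}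
    {a ε : ℝ≥0} (ha : (a : ℝ) ≤ f x) (hε : 0 < ε) :
    ∀ᶠ z in 𝓝 x, (((1 - ε) * a : ℝ≥0) : ℝ) ≤ f z := by
  rcases eq_or_ne a 0 with rfl | h
  · exact Eventually.of_forall fun z => by simpa using hf0 z
  · have hlt : (((1 - ε) * a : ℝ≥0) : ℝ) < f x := by
      refine lt_of_lt_of_le (NNReal.coe_lt_coe.2 ?_) ha
      exact mul_lt_of_lt_one_left (pos_iff_ne_zero.2 h) (tsub_lt_self zero_lt_one hε)
    exact (hf.continuousAt.eventually_const_lt hlt).mono fun z hz => hz.le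

lemma a6 : A6 M.Gam M.ret where
  a _ hp _ hl _ := M.smul_mem_graph hp hl
  b := by
    obtain ⟨Φ, hΦ, hΦ1, hU⟩ := exists_utility_continuousOn M.θ
    -- Consumption is homogeneous of degree one, so (A6b) holds with equality for `Φ₁ l = l ^ θ` and
    -- `Φ₂ l = U(l)`.
    refine ⟨fun l => (l : ℝ) ^ M.θ, Φ, fun l hl => ?_, hΦ, by simp, hΦ1, ?_⟩
    · exact (NNReal.continuous_coe.continuousAt.rpow_const
        (.inl (NNReal.coe_ne_zero.2 hl.1.ne'))).continuousWithinAt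
    · intro p hp hne l hl _
      rw [M.ret_eq] at hne ⊢
      rw [M.ret_eq, M.consumption_smul hp hl, utility_mul hne (NNReal.coe_pos.2 hl), hU l hl]
  c x y hy := by
    obtain ⟨h1, h2⟩ := M.mem_Gam.1 hy
    refine ⟨1, zero_lt_one, le_rfl, fun ε hε _ => ?_⟩
    have hD : Continuous fun z : State => M.Dh * (z.2 : ℝ) := by fun_prop
    filter_upwards [eventually_one_sub_mul_le M.continuous_resources M.resources_nonneg h1 hε,
      eventually_one_sub_mul_le hD (fun z => mul_nonneg M.Dh_pos.le z.2.coe_nonneg) h2 hε]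
      with z hz1 hz2
    exact M.mem_Gam.2 ⟨hz1, hz2⟩

end Params

end GrowthModel

theorem proposition2 :
    -- the general result for `Γ`, `F`, `β` and an arbitrary norm `N` on `ℝ²`
    (∀ (β : ℝ) (Γ : GrowthModel.State → Set GrowthModel.State)
        (F : GrowthModel.State × GrowthModel.State → EReal)
        (N : Seminorm ℝ (ℝ × ℝ)) (ζ ζ' : ℝ),
      0 < β → β < 1 → (∀ p, F p ≠ ⊤) → (∀ v, N v = 0 → v = 0) →
      GrowthModel.A1 Γ → GrowthModel.A2 N Γ ζ ζ' → GrowthModel.A3 N Γ F →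
      GrowthModel.A4 β ζ → GrowthModel.A5 Γ F →
      -- the series of discounted returns has a sum in the extended reals along each feasible path
      (∀ x₀, ∀ x ∈ GrowthModel.feasible Γ x₀,
        Tendsto (GrowthModel.partialReturn β F x) atTop (𝓝 (GrowthModel.totalReturn β F x))) ∧
      -- (a)
      GrowthModel.SolvesBellman β Γ F (GrowthModel.value β Γ F) ∧
      -- (b)
      (GrowthModel.MemS β Γ F (GrowthModel.value β Γ F) ∧
        ∀ W, GrowthModel.MemS β Γ F W → GrowthModel.SolvesBellman β Γ F W →
          W = GrowthModel.value β Γ F) ∧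
      -- (c)
      (GrowthModel.A6 Γ F →
        (∀ x₀, ∀ x ∈ GrowthModel.feasibleFinite β Γ F x₀, ∀ t,
          ContinuousAt (GrowthModel.value β Γ F) (x t)) ∧
        (∀ x₀, GrowthModel.value β Γ F x₀ = ⊥ → ∀ u : ℕ → GrowthModel.State,
          Tendsto u atTop (𝓝 x₀) →
            Tendsto (fun n => GrowthModel.value β Γ F (u n)) atTop (𝓝 ⊥)))) ∧
    -- (A6) is verified by the two-sector model with isoelastic utility
    (∀ θ c l : ℝ, θ ≤ 1 → 0 < c → 0 < l →
      GrowthModel.utility θ (l * c) =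
        ((l ^ θ : ℝ) : EReal) * GrowthModel.utility θ c + GrowthModel.utility θ l) ∧
    (∀ M : GrowthModel.Params, GrowthModel.A6 M.Gam M.ret) := by
  refine ⟨?_, ?_, GrowthModel.Params.a6⟩
  · intro β Γ F N ζ ζ' hβ hβ1 hF _ h1 h2 h3 h4 h5
    obtain ⟨b, hb⟩ := GrowthModel.exists_isBound hβ hβ1 h2 h3 h4
    refine ⟨fun x₀ x hx => hb.tendsto hβ hx, hb.solvesBellman hβ hF h1 h5,
      ⟨hb.memS hβ hF h1 h5, fun W hS hW => hb.unique hβ hF h1 h5 hS hW⟩,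
      fun h6 => ⟨fun x₀ x hx t => hb.continuousAt_value hβ hβ1 hF h1 h5 h6 hx t,
        fun x₀ hV u hu => ?_⟩⟩
    exact (GrowthModel.tendsto_bot_of_upperSemicontinuous (hb.value_usc hβ hF h1 h5) hV).comp hu
  · intro θ c l _ hc hl
    exact GrowthModel.utility_mul (GrowthModel.utility_ne_bot hc) hl
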